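/- Let $k$ be a field, let $f=\sum_{i=0}^N\alpha_iX^i\in k[X]$ be a monic polynomial of degree $N$, and let $A=k[X]/(f)$. Let $d=\gcd(f,f')$ be a greatest common divisor of $f$ and its derivative $f'$, let $q\in k[X]$ be such that $f=qd$, and put $$u=q^2\sum_{i=0}^N\alpha_i\,\frac{i(i-1)}2\,X^{i-2}\in k[X],$$ where $i(i-1)/2$ denotes the image in $k$ of this integer, and the terms with $i<2$ are zero. Let $\mathrm{HH}^*(A)=\bigoplus_{n\ge0}\operatorname{Ext}^n_{A^e}(A,A)$ be the Hochschild cohomology of $A$, where $A^e=A\otimes_kA^{\mathrm{op}}$ is the enveloping algebra and $A$ is the regular bimodule, regarded as a graded $k$-algebra under the Yoneda product (which coincides with the cup product). Then $\mathrm{HH}^*(A)$ is graded commutative, that is, $ab=(-1)^{ij}ba$ for all $a\in\mathrm{HH}^i(A)$ and $b\in\mathrm{HH}^j(A)$, and there is an isomorphism of graded $k$-algebras $$\mathrm{HH}^*(A)\cong k[x,\tau,\zeta]\big/\big(f(x),\ \tau d(x),\ \zeta f'(x),\ \tau^2-u(x)\zeta\big),$$ where $k[x,\tau,\zeta]$ is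 the polynomial algebra in three variables and the generators on the right-hand side have degrees $|x|=0$, $|\tau|=1$ and $|\zeta|=2$. -/

import Mathlib

open CategoryTheory CategoryTheory.Abelian
open scoped TensorProduct DirectSum

universe u v

/-- The enveloping algebra `Aᵉ = A ⊗ₖ Aᵒᵖ` of a `k`-algebra `A`. Left `Aᵉ`-modules are
`A`-bimodules. -/
abbrev EnvelopingAlgebra (k : Type u) (A : Type v) [Field k] [Ring A] [Algebra k A] : Type v :=
  A ⊗[k] Aᵐᵒᵖ

/-- The regular bimodule `A`, as a left module over the enveloping algebra:
`(a ⊗ op b) • m = a * m * b`. -/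
noncomputable def regularBimodule (k : Type u) (A : Type v) [Field k] [Ring A] [Algebra k A] :
    ModuleCat.{v} (EnvelopingAlgebra k A) :=
  letI : Module (EnvelopingAlgebra k A) A := TensorProduct.Algebra.module
  ModuleCat.of (EnvelopingAlgebra k A) A

/-- The action of the enveloping algebra on the regular bimodule is the expected one. -/
theorem regularBimodule_smul (k : Type u) (A : Type v) [Field k] [Ring A] [Algebra k A]
    (a b m : A) :
    (show A from (a ⊗ₜ[k] MulOpposite.op b : EnvelopingAlgebra k A) •
      (show regularBimodule k A from m)) = a * m * b := by
  change a • MulOpposite.op b • m = a * m * b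
  simp [mul_assoc]

/-- Hochschild cohomology `HHⁿ(A) = Extⁿ_{Aᵉ}(A, A)`. -/
abbrev HH (k : Type u) (A : Type v) [Field k] [Ring A] [Algebra k A] (n : ℕ) : Type v :=
  Ext.{v} (regularBimodule k A) (regularBimodule k A) n

/-- The direct sum `HH^*(A) = ⨁ₙ HHⁿ(A)`. -/
abbrev HHStar (k : Type u) (A : Type v) [Field k] [Ring A] [Algebra k A] : Type v :=
  ⨁ n : ℕ, HH k A n

section Yoneda

variable (k : Type u) (A : Type v) [Field k] [Ring A] [Algebra k A]

theorem HH.mk_comp_eq {i j n m : ℕ} (a : HH k A i) (b : HH k A j) (h : i + j = n)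
    (h' : i + j = m) :
    (GradedMonoid.mk n (a.comp b h) : GradedMonoid (HH k A)) =
      GradedMonoid.mk m (a.comp b h') := by
  subst h
  subst h'
  rfl

/-- The Yoneda product: `a * b` is the composite `a ∘ b` (first `b`, then `a`). The unit is the
identity morphism of the regular bimodule. -/
noncomputable instance HH.instGMul : GradedMonoid.GMul (HH k A) where
  mul {i j} a b := b.comp a (add_comm j i)

noncomputable instance HH.instGOne : GradedMonoid.GOne (HH k A) where
  one := Ext.mk₀ (𝟙 (regularBimodule k A))

noncomputable instance HH.instGMonoid : GradedMonoid.GMonoid (HH k A) where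
  one_mul := by
    rintro ⟨i, a⟩
    refine (HH.mk_comp_eq k A a (Ext.mk₀ (𝟙 _)) _ (add_zero i)).trans ?_
    exact congrArg (GradedMonoid.mk i) (Ext.comp_mk₀_id a)
  mul_one := by
    rintro ⟨i, a⟩
    refine (HH.mk_comp_eq k A (Ext.mk₀ (𝟙 _)) a _ (zero_add i)).trans ?_
    exact congrArg (GradedMonoid.mk i) (Ext.mk₀_id_comp a)
  mul_assoc := by
    rintro ⟨i, a⟩ ⟨j, b⟩ ⟨l, c⟩
    refine (HH.mk_comp_eq k A c (b.comp a (add_comm j i)) _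
      (show l + (i + j) = i + (j + l) by omega)).trans ?_
    exact congrArg (GradedMonoid.mk (i + (j + l)))
      (Ext.comp_assoc c b a (add_comm l j) (add_comm j i) (by omega)).symm

noncomputable instance HH.instGRing : DirectSum.GRing (HH k A) where
  __ := HH.instGMonoid k A
  mul_zero {i j} a := Ext.zero_comp _ j a _ (add_comm j i)
  zero_mul {i j} b := Ext.comp_zero b _ i _ (add_comm j i)
  mul_add {i j} a b c := Ext.add_comp b c a (add_comm j i)
  add_mul {i j} a b c := Ext.comp_add c a b (add_comm j i)
  natCast n := n • Ext.mk₀ (𝟙 (regularBimodule k A))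
  natCast_zero := zero_smul _ _
  natCast_succ n := succ_nsmul _ n
  intCast n := n • Ext.mk₀ (𝟙 (regularBimodule k A))
  intCast_ofNat n := natCast_zsmul _ n
  intCast_negSucc_ofNat n := negSucc_zsmul _ n

theorem HH.comp_smul_id (r : k) {i : ℕ} (a : HH k A i) (h : i + 0 = i) :
    a.comp (r • Ext.mk₀ (𝟙 (regularBimodule k A))) h = r • a := by
  rw [Ext.comp_smul, Ext.comp_mk₀_id]

theorem HH.smul_id_comp (r : k) {i : ℕ} (a : HH k A i) (h : 0 + i = i) :
    (r • Ext.mk₀ (𝟙 (regularBimodule k A))).comp a h = r • a := by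
  rw [Ext.smul_comp, Ext.mk₀_id_comp]

/-- The scalars act through `r ↦ r • 𝟙`; this makes `HH^*(A)` a `k`-algebra. -/
noncomputable instance HH.instGAlgebra : DirectSum.GAlgebra k (HH k A) where
  toFun :=
    { toFun := fun r => r • Ext.mk₀ (𝟙 (regularBimodule k A))
      map_zero' := zero_smul _ _
      map_add' := fun r s => add_smul r s _ }
  map_one := one_smul _ _
  map_mul r s := by
    refine congrArg (GradedMonoid.mk 0) ?_
    exact (mul_smul r s _).trans (HH.comp_smul_id k A r _ (add_zero 0)).symm
  commutes := by
    rintro r ⟨i, a⟩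
    refine (HH.mk_comp_eq k A a (r • Ext.mk₀ (𝟙 (regularBimodule k A))) (add_comm i 0)
      (add_zero i)).trans ?_
    refine Eq.trans ?_ (HH.mk_comp_eq k A (r • Ext.mk₀ (𝟙 (regularBimodule k A))) a (add_comm 0 i)
      (zero_add i)).symm
    exact congrArg (GradedMonoid.mk i)
      ((HH.comp_smul_id k A r a _).trans (HH.smul_id_comp k A r a _).symm)
  smul_def := by
    rintro r ⟨i, a⟩
    refine Eq.trans ?_ (HH.mk_comp_eq k A a (r • Ext.mk₀ (𝟙 (regularBimodule k A))) (add_comm i 0)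
      (add_zero i)).symm
    exact congrArg (GradedMonoid.mk i) (HH.comp_smul_id k A r a _).symm

end Yoneda

/-- The polynomial `q² ∑ᵢ αᵢ (i(i-1)/2) X^{i-2}`, where `f = ∑ᵢ αᵢ Xⁱ`. The number `i(i-1)/2` is
an integer, mapped to `k` after the division; it is `0` for `i < 2`. -/
noncomputable def monogenicU {k : Type u} [Field k] (f q : Polynomial k) : Polynomial k :=
  q ^ 2 * ∑ i ∈ Finset.range (f.natDegree + 1),
    Polynomial.C (f.coeff i * ((i * (i - 1) / 2 : ℕ) : k)) * Polynomial.X ^ (i - 2)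

/-- The ideal `(f(x), τ d(x), ζ f'(x), τ² - u(x) ζ)` of `k[x, τ, ζ]`, the three variables being
`x = X 0`, `τ = X 1`, `ζ = X 2`. -/
noncomputable def monogenicIdeal {k : Type u} [Field k] (f d u : Polynomial k) :
    Ideal (MvPolynomial (Fin 3) k) :=
  let x : MvPolynomial (Fin 3) k := MvPolynomial.X 0
  let τ : MvPolynomial (Fin 3) k := MvPolynomial.X 1
  let ζ : MvPolynomial (Fin 3) k := MvPolynomial.X 2
  Ideal.span {Polynomial.aeval x f, τ * Polynomial.aeval x d,
    ζ * Polynomial.aeval x (Polynomial.derivative f), τ ^ 2 - Polynomial.aeval x u * ζ}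

/-- The algebra `k[x, τ, ζ]/(f(x), τ d(x), ζ f'(x), τ² - u(x) ζ)`. -/
abbrev MonogenicPresentation {k : Type u} [Field k] (f d u : Polynomial k) : Type u :=
  MvPolynomial (Fin 3) k ⧸ monogenicIdeal f d u

/-- The component of degree `n` of the presented algebra, for the grading `|x| = 0`, `|τ| = 1`,
`|ζ| = 2`: the image of the polynomials that are homogeneous of weight `n`. -/
noncomputable def MonogenicPresentation.component {k : Type u} [Field k] (f d u : Polynomial k)
    (n : ℕ) : Submodule k (MonogenicPresentation f d u) :=
  (MvPolynomial.weightedHomogeneousSubmodule k (![0, 1, 2] : Fin 3 → ℕ) n).map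
    (Ideal.Quotient.mkₐ k (monogenicIdeal f d u)).toLinearMap

/-!
Write `A = k[x]/(f)`. The enveloping algebra `R = Aᵉ` is commutative, and it is `A[X]/(f(X))` with
`X = 1 ⊗ x`. Over `A` one has `f(X) = (X - x) t(X)`, and both factors are monic, so the classes of
`s = X - x` and `t` in `R` form an exact pair: each generates the annihilator of the other
(`isExactPair_map`). The regular bimodule is `R/(s)`. The two short exact sequences
`R/(t) → R → R/(s)` and `R/(s) → R → R/(t)` give classes `e₁ ∈ Ext¹(R/(s), R/(t))` and
`e₂ ∈ Ext¹(R/(t), R/(s))`, and `R` is projective. Set `ζ = e₁ e₂ ∈ HH²(A)`.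

The long exact sequences show that multiplication by `ζ` is surjective onto degrees at least two,
injective in positive degrees, and has kernel `f'A` in degree zero, because `t` acts on `A` as
`f'(x)`. They also identify `HH¹(A)` with the annihilator of `f'` in `A`, which is generated by the
class of `q = f / d`; the corresponding element is `τ`, the composite of `e₁` with the map
`R/(t) → R/(s)` given by `q`. Thus `HHⁿ(A)` is free of rank one over `k[x]/(d)` for `n > 0`, on the
monomial `τ^ε ζ^m` of degree `n` (`exists_tau_zeta`).

The ring structure comes from the naturality of extension classes: if `s a = t b`, then `a` and `b`
define a morphism between the two short exact sequences (`extClass_comp_desc`). By the Taylor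
expansion of `f` at `x` to the second order, `t q = s c` with `c` acting on `A` as `q f''/2`, where
`f''/2` is the second Hasse derivative. This gives `τ² = q c ζ = u ζ` and `τ ζ = ζ τ`. Everything
else commutes because composition in `Ext` is `R`-bilinear. So the whole ring is commutative, and
it is also graded commutative since `f` divides `2u = q² f''`, whence `2τ² = 0`.

Finally, the relations reduce every element of the presented algebra to a combination of the
monomials `p(x) τ^ε ζ^m` with `ε ≤ 1`, and the annihilators computed above show that no such
combination dies in `HH^*(A)` unless it is zero already
(`exists_algEquiv_monogenicPresentation`).
-/

open Polynomial

/-! ### Extensions of cyclic modules over an exact pair of zero divisors -/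

section Cyclic
variable {R : Type u} [CommRing R]

/-- `m` generates `M` and its annihilator is the principal ideal `(s)`, so that `M ≅ R/(s)`. -/
structure IsCyclicGenerator (M : ModuleCat.{u} R) (m : M) (s : R) : Prop where
  exists_smul_eq (y : M) : ∃ r : R, r • m = y
  smul_eq_zero_iff (r : R) : r • m = 0 ↔ s ∣ r

/-- `(s, t)` is an exact pair of zero divisors: each generates the annihilator of the other. -/
structure IsExactPair (s t : R) : Prop where
  mul_left_eq_zero_iff (r : R) : r * s = 0 ↔ t ∣ r
  mul_right_eq_zero_iff (r : R) : r * t = 0 ↔ s ∣ r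

theorem IsExactPair.symm {s t : R} (h : IsExactPair s t) : IsExactPair t s :=
  ⟨h.2, h.1⟩

theorem IsExactPair.mul_eq_zero {s t : R} (h : IsExactPair s t) : s * t = 0 :=
  (h.mul_right_eq_zero_iff s).2 dvd_rfl

namespace IsCyclicGenerator

variable {M N : ModuleCat.{u} R} {m : M} {n : N} {s t : R}

theorem smul_gen (hM : IsCyclicGenerator M m s) : s • m = 0 :=
  (hM.smul_eq_zero_iff s).2 dvd_rfl

theorem smul_eq_zero (hM : IsCyclicGenerator M m s) (y : M) : s • y = 0 := by
  obtain ⟨r, rfl⟩ := hM.exists_smul_eq y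
  rw [smul_comm, hM.smul_gen, smul_zero]

theorem hom_ext (hM : IsCyclicGenerator M m s) {P : ModuleCat.{u} R} {g g' : M ⟶ P}
    (h : g.hom m = g'.hom m) : g = g' := by
  ext y
  obtain ⟨r, rfl⟩ := hM.exists_smul_eq y
  rw [map_smul, map_smul, h]

theorem exists_hom (hM : IsCyclicGenerator M m s) {P : ModuleCat.{u} R} (p : P)
    (hp : s • p = 0) : ∃ g : M ⟶ P, g.hom m = p := by
  have hsurj : Function.Surjective (LinearMap.toSpanSingleton R M m) := hM.exists_smul_eq
  let e := (LinearMap.toSpanSingleton R M m).quotKerEquivOfSurjective hsurj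
  have hle : LinearMap.ker (LinearMap.toSpanSingleton R M m) ≤
      LinearMap.ker (LinearMap.toSpanSingleton R P p) := by
    intro r hr
    obtain ⟨c, rfl⟩ := (hM.smul_eq_zero_iff r).1 hr
    change (s * c) • p = 0
    rw [mul_comm, mul_smul, hp, smul_zero]
  refine ⟨ModuleCat.ofHom ((Submodule.liftQ _ _ hle).comp e.symm.toLinearMap), ?_⟩
  have he : e.symm m = Submodule.Quotient.mk 1 := by
    rw [LinearEquiv.symm_apply_eq]
    exact (one_smul R m).symm
  change (Submodule.liftQ _ _ hle) (e.symm m) = p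
  rw [he]
  exact one_smul R p

/-- The map out of a cyclic module `M ≅ R/(s)` sending the generator to an element killed
by `s`. -/
noncomputable def desc (hM : IsCyclicGenerator M m s) {P : ModuleCat.{u} R} (p : P)
    (hp : s • p = 0) : M ⟶ P :=
  (hM.exists_hom p hp).choose

@[simp]
theorem desc_gen (hM : IsCyclicGenerator M m s) {P : ModuleCat.{u} R} (p : P)
    (hp : s • p = 0) : (hM.desc p hp).hom m = p :=
  (hM.exists_hom p hp).choose_spec

@[simp]
theorem desc_smul_gen (hM : IsCyclicGenerator M m s) {P : ModuleCat.{u} R} (p : P)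
    (hp : s • p = 0) (r : R) : (hM.desc p hp).hom (r • m) = r • p := by
  rw [map_smul, desc_gen]

/-- The free module of rank one is cyclic with annihilator `(0)`. -/
theorem self : IsCyclicGenerator (ModuleCat.of R R) (1 : R) (0 : R) where
  exists_smul_eq y := ⟨y, mul_one y⟩
  smul_eq_zero_iff r := by
    change r * 1 = 0 ↔ _
    rw [mul_one, zero_dvd_iff]

theorem quotient (t : R) :
    IsCyclicGenerator (ModuleCat.of R (R ⧸ Ideal.span {t})) (Ideal.Quotient.mk _ 1) t where
  exists_smul_eq y := by
    obtain ⟨r, rfl⟩ := Ideal.Quotient.mk_surjective y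
    refine ⟨r, ?_⟩
    rw [← Ideal.Quotient.mk_eq_mk, ← Submodule.Quotient.mk_smul, smul_eq_mul, mul_one]
    rfl
  smul_eq_zero_iff r := by
    rw [← Ideal.Quotient.mk_eq_mk, ← Submodule.Quotient.mk_smul, smul_eq_mul, mul_one,
      Submodule.Quotient.mk_eq_zero, Ideal.mem_span_singleton]

/-- For an exact pair `(s, t)`, multiplication by `s` as an injection `R/(t) → R`. -/
noncomputable def mulHom (hN : IsCyclicGenerator N n t) (h : IsExactPair s t) :
    N ⟶ ModuleCat.of R R :=
  hN.desc (P := ModuleCat.of R R) s (by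
    change t * s = 0
    rw [mul_comm]; exact h.mul_eq_zero)

/-- The projection `R → R/(s)`. -/
noncomputable def proj (m : M) : ModuleCat.of R R ⟶ M :=
  ModuleCat.ofHom (LinearMap.toSpanSingleton R M m)

theorem mulHom_gen (hN : IsCyclicGenerator N n t) (h : IsExactPair s t) :
    (hN.mulHom h).hom n = s :=
  desc_gen hN (P := ModuleCat.of R R) s _

theorem mulHom_smul (hN : IsCyclicGenerator N n t) (h : IsExactPair s t) (r : R) :
    (hN.mulHom h).hom (r • n) = r * s :=
  desc_smul_gen hN (P := ModuleCat.of R R) s _ r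

theorem proj_apply (m : M) (r : R) : (proj m).hom r = r • m := rfl

theorem mulHom_proj (hM : IsCyclicGenerator M m s) (hN : IsCyclicGenerator N n t)
    (h : IsExactPair s t) : hN.mulHom h ≫ proj m = 0 :=
  hN.hom_ext (by
    rw [ModuleCat.hom_comp, LinearMap.comp_apply, mulHom_gen, proj_apply]
    exact hM.smul_gen)

/-- For an exact pair `(s, t)`, the complex `R/(t) → R → R/(s)` whose first map is multiplication
by `s`. -/
noncomputable def shortComplex (hM : IsCyclicGenerator M m s) (hN : IsCyclicGenerator N n t)
    (h : IsExactPair s t) : ShortComplex (ModuleCat.{u} R) :=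
  ShortComplex.mk (hN.mulHom h) (proj m) (hM.mulHom_proj hN h)

variable (hM : IsCyclicGenerator M m s) (hN : IsCyclicGenerator N n t) (h : IsExactPair s t)

theorem shortExact : (shortComplex hM hN h).ShortExact := by
  have hf : Mono (hN.mulHom h) := by
    rw [ModuleCat.mono_iff_injective, injective_iff_map_eq_zero]
    intro y hy
    obtain ⟨r, rfl⟩ := hN.exists_smul_eq y
    exact (hN.smul_eq_zero_iff r).2
      ((h.mul_left_eq_zero_iff r).1 ((hN.mulHom_smul h r).symm.trans hy))
  have hg : Epi (proj m) := by
    rw [ModuleCat.epi_iff_surjective]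
    exact hM.exists_smul_eq
  refine { exact := ?_, mono_f := hf, epi_g := hg }
  rw [ShortComplex.moduleCat_exact_iff]
  intro (r : R) hr
  obtain ⟨c, rfl⟩ := (hM.smul_eq_zero_iff r).1 hr
  exact ⟨(c • n : N), (mulHom_smul hN h c).trans (mul_comm c s)⟩

/-- The class in `Ext¹(R/(s), R/(t))` of the extension `R/(t) → R → R/(s)`. -/
noncomputable def extClass : Ext.{u} M N 1 :=
  (shortExact hM hN h).extClass

/-- If `s * a = t * b`, then multiplication by `a` on `R` extends to a morphism from
the extension `R/(t) → R → R/(s)` to the extension `R/(s) → R → R/(t)`. -/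
theorem extClass_comp_desc {a b : R} (hab : s * a = t * b) (ha : s • a • n = 0)
    (hb : t • b • m = 0) :
    (extClass hM hN h).comp (Ext.mk₀ (hN.desc (b • m) hb)) (add_zero 1) =
      (Ext.mk₀ (hM.desc (a • n) ha)).comp (extClass hN hM h.symm) (zero_add 1) := by
  let φ : shortComplex hM hN h ⟶ shortComplex hN hM h.symm :=
    { τ₁ := hN.desc (b • m) hb
      τ₂ := ModuleCat.ofHom (a • LinearMap.id)
      τ₃ := hM.desc (a • n) ha
      comm₁₂ := hN.hom_ext (by
        change (hM.mulHom h.symm).hom ((hN.desc (b • m) hb).hom n) = a * (hN.mulHom h).hom n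
        rw [desc_gen, mulHom_gen, mulHom_smul, mul_comm b, ← hab, mul_comm])
      comm₂₃ := self.hom_ext (by
        change (a * 1 : R) • n = (hM.desc (a • n) ha).hom ((1 : R) • m)
        rw [desc_smul_gen, one_smul, mul_one]) }
  exact ShortComplex.ShortExact.extClass_naturality (shortExact hM hN h)
    (shortExact hN hM h.symm) φ

theorem ext_self_eq_zero {P : ModuleCat.{u} R} {i : ℕ}
    (y : Ext.{u} (ModuleCat.of R R) P (i + 1)) : y = 0 :=
  have : Projective (ModuleCat.of R R) := inferInstance
  Ext.eq_zero_of_projective y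

/-- Dimension shifting along `R/(t) → R → R/(s)`: precomposition with the extension class is
surjective, because `Ext` of positive degree vanishes on `R`. -/
theorem exists_extClass_comp_eq {P : ModuleCat.{u} R} {i j : ℕ} (hij : 1 + i = j)
    (y : Ext.{u} M P j) : ∃ y' : Ext.{u} N P i, (extClass hM hN h).comp y' hij = y := by
  refine Ext.contravariant_sequence_exact₃ (shortExact hM hN h) P y ?_ hij
  obtain rfl : j = i + 1 := by omega
  exact ext_self_eq_zero _

/-- Dimension shifting along `R/(t) → R → R/(s)`: precomposition with the extension class is
injective in positive degrees. -/
theorem eq_zero_of_extClass_comp {P : ModuleCat.{u} R} {i j : ℕ} (hij : 1 + (i + 1) = j)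
    (y : Ext.{u} N P (i + 1)) (hy : (extClass hM hN h).comp y hij = 0) : y = 0 := by
  obtain ⟨x, hx⟩ := Ext.contravariant_sequence_exact₁ (shortExact hM hN h) P y hij hy
  rw [← hx, (ext_self_eq_zero x : x = 0)]
  exact Ext.comp_zero _ _ _ _ _

/-- In degree `0`, precomposition with the extension class kills exactly the homomorphisms that
extend from `R/(t)` to `R` along multiplication by `s`. -/
theorem extClass_comp_mk₀_eq_zero_iff {P : ModuleCat.{u} R} (g : N ⟶ P) :
    (extClass hM hN h).comp (Ext.mk₀ g) (add_zero 1) = 0 ↔ ∃ p : P, g.hom n = s • p := by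
  constructor
  · intro hy
    obtain ⟨x, hx⟩ := Ext.contravariant_sequence_exact₁ (shortExact hM hN h) P _ (add_zero 1) hy
    obtain ⟨(x : ModuleCat.of R R ⟶ P), rfl⟩ := (Ext.mk₀_bijective _ _).2 x
    have hg : hN.mulHom h ≫ x = g :=
      (Ext.mk₀_bijective _ _).1 ((Ext.mk₀_comp_mk₀ _ _).symm.trans hx)
    refine ⟨x.hom (1 : R), ?_⟩
    rw [← hg, ModuleCat.hom_comp, LinearMap.comp_apply, mulHom_gen]
    refine Eq.trans ?_ (map_smul x.hom s (1 : R))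
    exact congrArg x.hom (mul_one s).symm
  · rintro ⟨p, hp⟩
    have : g = hN.mulHom h ≫ proj p := hN.hom_ext (by
      rw [hp, ModuleCat.hom_comp, LinearMap.comp_apply, mulHom_gen, proj_apply])
    rw [this, ← Ext.mk₀_comp_mk₀]
    exact (shortExact hM hN h).extClass_comp_assoc (h := add_zero 1) _


theorem smul_ext_eq_zero {P : ModuleCat.{u} R} {i : ℕ} (hM : IsCyclicGenerator M m s)
    (y : Ext.{u} P M i) : s • y = 0 := by
  have : s • 𝟙 M = 0 := hM.hom_ext hM.smul_gen
  rw [Ext.smul_eq_comp_mk₀, this, Ext.mk₀_zero, Ext.comp_zero]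

theorem exists_smul_id_eq (hM : IsCyclicGenerator M m s) (y : Ext.{u} M M 0) :
    ∃ r : R, y = r • Ext.mk₀ (𝟙 M) := by
  obtain ⟨g, rfl⟩ := (Ext.mk₀_bijective _ _).2 y
  obtain ⟨r, hr⟩ := hM.exists_smul_eq (g.hom m)
  refine ⟨r, ?_⟩
  rw [← Ext.mk₀_smul]
  exact congrArg _ (hM.hom_ext hr.symm)

theorem smul_id_eq_zero_iff (hM : IsCyclicGenerator M m s) (r : R) :
    r • Ext.mk₀.{u} (𝟙 M) = 0 ↔ s ∣ r := by
  rw [← Ext.mk₀_smul, Ext.mk₀_eq_zero_iff, ← hM.smul_eq_zero_iff]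
  constructor
  · intro h0
    exact congrArg (fun g : M ⟶ M => g.hom m) h0
  · intro h0
    exact hM.hom_ext h0

/-- The class in `Ext²(R/(s), R/(s))` of the extension `R/(s) → R → R → R/(s)`. -/
noncomputable def zetaClass : Ext.{u} M M 2 :=
  (extClass hM hN h).comp (extClass hN hM h.symm) rfl

/-- The image in `Ext¹(R/(s), R/(s))` of the class of `R/(t) → R → R/(s)` under the map
`R/(t) → R/(s)` induced by multiplication by `q`, for `q` with `t * q ∈ (s)`. -/
noncomputable def tauClass {q : R} (hq : t • q • m = 0) : Ext.{u} M M 1 :=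
  (extClass hM hN h).comp (Ext.mk₀ (hN.desc (q • m) hq)) (add_zero 1)

/-- With `t * q = s * c`, the map `R/(t) → R/(s)` given by `q` moves past an extension class and
becomes the map `R/(s) → R/(t)` given by `c`; hence `τ²` is `q * c` times `ζ`. -/
theorem tauClass_comp_tauClass {q c : R} (hqc : t * q = s * c) (hq : t • q • m = 0) :
    (tauClass hM hN h hq).comp (tauClass hM hN h hq) rfl = (q * c) • zetaClass hM hN h := by
  have hc : s • c • n = 0 := by
    rw [← mul_smul, ← hqc, mul_comm, mul_smul, hN.smul_gen, smul_zero]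
  have key := extClass_comp_desc hM hN h hqc.symm hc hq
  have hcomp : hN.desc (q • m) hq ≫ hM.desc (c • n) hc = (q * c) • 𝟙 N := hN.hom_ext (by
    rw [ModuleCat.hom_comp, LinearMap.comp_apply, desc_gen, desc_smul_gen, ← mul_smul]
    rfl)
  calc (tauClass hM hN h hq).comp (tauClass hM hN h hq) rfl
      = (tauClass hM hN h hq).comp ((Ext.mk₀ (hM.desc (c • n) hc)).comp
          (extClass hN hM h.symm) (zero_add 1)) rfl := by rw [← key]; rfl
    _ = (extClass hM hN h).comp ((Ext.mk₀ (hN.desc (q • m) hq)).comp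
          ((Ext.mk₀ (hM.desc (c • n) hc)).comp
          (extClass hN hM h.symm) (zero_add 1)) (zero_add 1)) rfl :=
        Ext.comp_assoc _ _ _ _ _ (by omega)
    _ = (extClass hM hN h).comp ((q * c) • extClass hN hM h.symm) rfl := by
        rw [Ext.mk₀_comp_mk₀_assoc, hcomp, Ext.mk₀_smul, Ext.smul_comp, Ext.mk₀_id_comp]
    _ = _ := Ext.comp_smul _ _ _ _

/-- `τ` and `ζ` commute: with `t * q = s * c`, both composites are the class
`R/(s) → R/(t) → R/(s) → R/(t)` followed by the map `R/(t) → R/(s)` given by `q`. -/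
theorem tauClass_comp_zetaClass {q c : R} (hqc : t * q = s * c) (hq : t • q • m = 0) :
    (tauClass hM hN h hq).comp (zetaClass hM hN h) (by omega : 1 + 2 = 3) =
      (zetaClass hM hN h).comp (tauClass hM hN h hq) rfl := by
  have hc : s • c • n = 0 := by
    rw [← mul_smul, ← hqc, mul_comm, mul_smul, hN.smul_gen, smul_zero]
  have key := extClass_comp_desc hM hN h hqc.symm hc hq
  have key' := extClass_comp_desc hN hM h.symm hqc hq hc
  calc (tauClass hM hN h hq).comp (zetaClass hM hN h) (by omega : 1 + 2 = 3)
      = (extClass hM hN h).comp ((Ext.mk₀ (hN.desc (q • m) hq)).comp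
          (zetaClass hM hN h) (zero_add 2)) rfl :=
        Ext.comp_assoc _ _ _ _ _ (by omega)
    _ = (extClass hM hN h).comp (((Ext.mk₀ (hN.desc (q • m) hq)).comp
          (extClass hM hN h) (zero_add 1)).comp (extClass hN hM h.symm) rfl) rfl := by
        rw [Ext.comp_assoc (a₁₂ := 1) _ _ _ (zero_add 1) rfl (by omega), zetaClass]
    _ = (extClass hM hN h).comp (((extClass hN hM h.symm).comp
          (Ext.mk₀ (hM.desc (c • n) hc)) (add_zero 1)).comp (extClass hN hM h.symm) rfl) rfl := by
        rw [key']
    _ = (extClass hM hN h).comp ((extClass hN hM h.symm).comp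
          (tauClass hM hN h hq) rfl) rfl := by
        rw [Ext.comp_assoc (a₂₃ := 1) _ _ _ (add_zero 1) (zero_add 1) (by omega), ← key]
        rfl
    _ = _ := (Ext.comp_assoc _ _ _ _ _ (by omega)).symm

/-- The annihilator of `ζ` consists of the endomorphisms of `R/(s)` that factor through
multiplication by `t`, as a map `R/(s) → R`. -/
theorem smul_zetaClass_eq_zero_iff (r : R) :
    r • zetaClass hM hN h = 0 ↔ ∃ c, s ∣ r - t * c := by
  have hr : r • zetaClass hM hN h = (extClass hM hN h).comp ((extClass hN hM h.symm).comp
      (Ext.mk₀ (r • 𝟙 M)) (add_zero 1)) rfl := by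
    rw [← Ext.smul_eq_comp_mk₀, Ext.comp_smul]
    rfl
  have h0 : r • zetaClass hM hN h = 0 ↔ (extClass hN hM h.symm).comp
      (Ext.mk₀ (r • 𝟙 M)) (add_zero 1) = 0 := by
    rw [hr]
    refine ⟨eq_zero_of_extClass_comp hM hN h _ _, fun h0 => ?_⟩
    rw [h0, Ext.comp_zero]
  rw [h0, extClass_comp_mk₀_eq_zero_iff]
  have hm : (r • 𝟙 M : M ⟶ M).hom m = r • m := rfl
  rw [hm]
  constructor
  · rintro ⟨p, hp⟩
    obtain ⟨c, rfl⟩ := hM.exists_smul_eq p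
    refine ⟨c, (hM.smul_eq_zero_iff _).1 ?_⟩
    rw [sub_smul, mul_smul, hp, sub_self]
  · rintro ⟨c, hc⟩
    refine ⟨c • m, ?_⟩
    rw [← sub_eq_zero, ← mul_smul, ← sub_smul]
    exact (hM.smul_eq_zero_iff _).2 hc

/-- If `q` generates the annihilator of `t` in `R/(s)`, then `τ` generates `Ext¹`. -/
theorem exists_smul_tauClass_eq {q : R} (hq : t • q • m = 0)
    (hann : ∀ a, s ∣ t * a → ∃ b, s ∣ a - b * q) (y : Ext.{u} M M 1) :
    ∃ r : R, y = r • tauClass hM hN h hq := by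
  obtain ⟨g, rfl⟩ := exists_extClass_comp_eq hM hN h (add_zero 1) y
  obtain ⟨g, rfl⟩ := (Ext.mk₀_bijective _ _).2 g
  obtain ⟨a, ha⟩ := hM.exists_smul_eq (g.hom n)
  obtain ⟨b, hb⟩ := hann a <| (hM.smul_eq_zero_iff _).1 <| by
    rw [mul_smul, ha, ← map_smul, hN.smul_gen, map_zero]
  refine ⟨b, ?_⟩
  rw [tauClass, ← Ext.comp_smul, ← Ext.mk₀_smul]
  congr 2
  refine hN.hom_ext (ha.symm.trans ?_)
  have : (b • hN.desc (q • m) hq).hom n = b • (hN.desc (q • m) hq).hom n := rfl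
  rw [this, desc_gen, ← mul_smul, ← sub_eq_zero, ← sub_smul]
  exact (hM.smul_eq_zero_iff _).2 hb

theorem smul_tauClass_eq_zero_iff {q : R} (hq : t • q • m = 0) (r : R) :
    r • tauClass hM hN h hq = 0 ↔ s ∣ r * q := by
  rw [tauClass, ← Ext.comp_smul, ← Ext.mk₀_smul, extClass_comp_mk₀_eq_zero_iff]
  have : (r • hN.desc (q • m) hq).hom n = r • (hN.desc (q • m) hq).hom n := rfl
  rw [this, desc_gen, ← mul_smul, ← hM.smul_eq_zero_iff]
  refine ⟨fun ⟨p, hp⟩ => hp.trans (hM.smul_eq_zero p), fun h0 => ⟨0, ?_⟩⟩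
  rw [h0, smul_zero]

theorem exists_zetaClass_comp_eq {i j : ℕ} (hij : 2 + i = j) (y : Ext.{u} M M j) :
    ∃ y' : Ext.{u} M M i, (zetaClass hM hN h).comp y' hij = y := by
  obtain ⟨x, rfl⟩ := exists_extClass_comp_eq hM hN h (i := 1 + i) (by omega) y
  obtain ⟨x, rfl⟩ := exists_extClass_comp_eq hN hM h.symm (i := i) (by omega) x
  exact ⟨x, Ext.comp_assoc _ _ _ _ _ (by omega)⟩

theorem eq_zero_of_zetaClass_comp {i j : ℕ} (hij : 2 + (i + 1) = j) (y : Ext.{u} M M (i + 1))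
    (hy : (zetaClass hM hN h).comp y hij = 0) : y = 0 := by
  have h₁ : 1 + (i + 1) = i + 1 + 1 := by omega
  have h₂ : 1 + (i + 1 + 1) = j := by omega
  refine eq_zero_of_extClass_comp hN hM h.symm h₁ y ?_
  refine eq_zero_of_extClass_comp hM hN h h₂ _ ?_
  rw [← hy, zetaClass, Ext.comp_assoc _ _ _ rfl h₁ (by omega)]

end IsCyclicGenerator
end Cyclic

/-! ### The enveloping algebra of a monogenic algebra -/

section Taylor

/-- The Taylor expansion of `f` at `x` to the second order. The Hasse derivative stands for
`f'' / 2`, which makes sense in every characteristic. -/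
theorem exists_eq_taylor_two {S : Type*} [CommRing S] (f : S[X]) (x : S) :
    ∃ g : S[X], f = C (f.eval x) + (X - C x) * (C ((derivative f).eval x) +
      (X - C x) * (C ((hasseDeriv 2 f).eval x) + (X - C x) * g)) := by
  let p := taylor x f
  refine ⟨p.divX.divX.divX.comp (X - C x), ?_⟩
  have h0 : p = C (p.coeff 0) + X * (C (p.coeff 1) + X * (C (p.coeff 2) +
      X * p.divX.divX.divX)) := by
    have h1 := divX_mul_X_add p
    have h2 := divX_mul_X_add p.divX
    have h3 := divX_mul_X_add p.divX.divX
    rw [coeff_divX] at h2 h3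
    rw [coeff_divX] at h3
    conv_lhs => rw [← h1, ← h2, ← h3]
    ring
  have h4 : p.comp (X - C x) = f := by
    simp [p, taylor_apply, comp_assoc]
  refine h4.symm.trans ((congrArg (fun r => r.comp (X - C x)) h0).trans ?_)
  simp [p, taylor_coeff]

/-- If `s * t = F` with `s`, `t` monic, then `(s, t)` becomes an exact pair modulo `F`. -/
theorem isExactPair_map {S R : Type*} [CommRing S] [CommRing R] (ψ : S[X] →+* R)
    (hψ : Function.Surjective ψ) {s t : S[X]} (hs : s.Monic) (ht : t.Monic)
    (hker : ∀ p, ψ p = 0 ↔ s * t ∣ p) : IsExactPair (ψ s) (ψ t) := by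
  have key (a b : S[X]) (hb : b.Monic) (hab : ∀ p, ψ p = 0 ↔ a * b ∣ p) (r : R) :
      r * ψ b = 0 ↔ ψ a ∣ r := by
    constructor
    · obtain ⟨p, rfl⟩ := hψ r
      rw [← map_mul, hab]
      rintro ⟨c, hc⟩
      refine ⟨ψ c, ?_⟩
      rw [← map_mul]
      congr 1
      refine hb.isRegular.right (hc.trans ?_)
      ring
    · rintro ⟨c, rfl⟩
      have : ψ (a * b) = 0 := (hab _).2 dvd_rfl
      rw [map_mul] at this
      rw [mul_right_comm, this, zero_mul]
  exact ⟨key t s hs (by simpa only [mul_comm t s] using hker), key s t ht hker⟩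

end Taylor

section Ring
variable {k : Type u} [Field k] (f : k[X])

/-- The presentation of `Aᵉ` as a quotient of `A[X]`, for `A = k[x]/(f)`: coefficients go to the
left factor, and `X` goes to `1 ⊗ x`. -/
noncomputable def polyToEnveloping :
    (AdjoinRoot f)[X] →+* EnvelopingAlgebra k (AdjoinRoot f) :=
  eval₂RingHom Algebra.TensorProduct.includeLeftRingHom (1 ⊗ₜ MulOpposite.op (AdjoinRoot.root f))

theorem polyToEnveloping_monomial (a : AdjoinRoot f) (i : ℕ) :
    polyToEnveloping f (C a * X ^ i) = a ⊗ₜ MulOpposite.op (AdjoinRoot.root f ^ i) := by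
  simp [polyToEnveloping]

theorem polyToEnveloping_map (p : k[X]) :
    polyToEnveloping f (p.map (algebraMap k _)) =
      1 ⊗ₜ MulOpposite.op (AdjoinRoot.mk f p) := by
  induction p using Polynomial.induction_on' with
  | add p q hp hq =>
    rw [Polynomial.map_add, map_add, hp, hq, map_add, MulOpposite.op_add, TensorProduct.tmul_add]
  | monomial n a =>
    rw [map_monomial, ← C_mul_X_pow_eq_monomial, polyToEnveloping_monomial,
      ← C_mul_X_pow_eq_monomial, map_mul, map_pow, AdjoinRoot.mk_X, Algebra.algebraMap_eq_smul_one,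
      TensorProduct.smul_tmul, AdjoinRoot.mk_C, Algebra.smul_def,
      mul_comm (AdjoinRoot.of f a)]
    rfl

theorem polyToEnveloping_surjective : Function.Surjective (polyToEnveloping f) := by
  intro r
  induction r using TensorProduct.induction_on with
  | zero => exact ⟨0, map_zero _⟩
  | add r r' hr hr' =>
    obtain ⟨p, rfl⟩ := hr
    obtain ⟨p', rfl⟩ := hr'
    exact ⟨p + p', map_add _ _ _⟩
  | tmul a b =>
    obtain ⟨p, hp⟩ := AdjoinRoot.mk_surjective b.unop
    refine ⟨C a * p.map (algebraMap k _), ?_⟩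
    rw [map_mul, polyToEnveloping_map, hp]
    simp [polyToEnveloping]

/-- The kernel is generated by `f(X)`: the remainder of division by `f` is determined by its image,
since the `1 ⊗ xⁱ` with `i < deg f` form a basis of `Aᵉ` over `A ⊗ 1`. -/
theorem polyToEnveloping_eq_zero_iff (hf : f.Monic) (p : (AdjoinRoot f)[X]) :
    polyToEnveloping f p = 0 ↔ f.map (algebraMap k _) ∣ p := by
  nontriviality AdjoinRoot f
  have hF : (f.map (algebraMap k (AdjoinRoot f))).Monic := hf.map _
  have hF0 : polyToEnveloping f (f.map (algebraMap k (AdjoinRoot f))) = 0 := by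
    rw [polyToEnveloping_map, AdjoinRoot.mk_self, MulOpposite.op_zero, TensorProduct.tmul_zero]
  constructor
  · intro hp
    rw [← modByMonic_eq_zero_iff_dvd hF]
    set r := p %ₘ f.map (algebraMap k (AdjoinRoot f)) with hr
    have hr0 : polyToEnveloping f r = 0 := by
      have h := congrArg (polyToEnveloping f) (modByMonic_add_div p
        (f.map (algebraMap k (AdjoinRoot f))))
      rwa [map_add, map_mul, hF0, zero_mul, add_zero, hp] at h
    have hF1 : f.map (algebraMap k (AdjoinRoot f)) ≠ 1 := by
      intro h1
      have hf1 : f = 1 := hf.natDegree_eq_zero.1 <| by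
        rw [← hf.natDegree_map (algebraMap k (AdjoinRoot f)), h1, natDegree_one]
      refine one_ne_zero (α := AdjoinRoot f) ?_
      rw [← map_one (AdjoinRoot.mk f), AdjoinRoot.mk_eq_zero, hf1]
    have hdeg : r.natDegree < f.natDegree := by
      rw [← hf.natDegree_map (algebraMap k (AdjoinRoot f))]
      exact natDegree_modByMonic_lt _ hF hF1
    obtain ⟨pb, hdim, hgen⟩ : ∃ pb : PowerBasis k (AdjoinRoot f),
        pb.dim = f.natDegree ∧ pb.gen = AdjoinRoot.root f :=
      ⟨AdjoinRoot.powerBasis' hf, rfl, rfl⟩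
    rw [← hdim] at hdeg
    let b := Algebra.TensorProduct.basis (AdjoinRoot f) (pb.basis.map (MulOpposite.opLinearEquiv k))
    have hb (i : Fin pb.dim) : b i = 1 ⊗ₜ MulOpposite.op (AdjoinRoot.root f ^ (i : ℕ)) := by
      rw [Algebra.TensorProduct.basis_apply, Module.Basis.map_apply, pb.basis_eq_pow, hgen]
      rfl
    have hli := Fintype.linearIndependent_iff.1 b.linearIndependent (fun i => r.coeff i) (by
      rw [← hr0]
      conv_rhs => rw [r.as_sum_range_C_mul_X_pow' hdeg, map_sum, Finset.sum_range]
      refine Finset.sum_congr rfl fun i _ => ?_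
      rw [polyToEnveloping_monomial, hb, TensorProduct.smul_tmul', smul_eq_mul, mul_one])
    ext i
    by_cases hi : i < pb.dim
    · exact hli ⟨i, hi⟩
    · exact coeff_eq_zero_of_natDegree_lt (by omega)
  · rintro ⟨c, rfl⟩
    rw [map_mul, hF0, zero_mul]

/-- On the regular bimodule, the element `p(X)` of `A[X]` acts on `1` through the substitution
`X = x`, which is the multiplication map of `A`. -/
theorem polyToEnveloping_smul (p : (AdjoinRoot f)[X]) :
    polyToEnveloping f p • (show regularBimodule k (AdjoinRoot f) from (1 : AdjoinRoot f)) =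
      p.eval (AdjoinRoot.root f) := by
  induction p using Polynomial.induction_on' with
  | add p q hp hq =>
    rw [map_add, add_smul, hp, hq, eval_add]
    rfl
  | monomial n a =>
    rw [← C_mul_X_pow_eq_monomial, polyToEnveloping_monomial]
    refine (regularBimodule_smul k (AdjoinRoot f) a _ 1).trans ?_
    simp

theorem isCyclicGenerator_regularBimodule :
    IsCyclicGenerator (regularBimodule k (AdjoinRoot f)) (1 : AdjoinRoot f)
      (polyToEnveloping f (X - C (AdjoinRoot.root f))) where
  exists_smul_eq y := ⟨polyToEnveloping f (C (show AdjoinRoot f from y)), by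
    have h := polyToEnveloping_smul f (C (show AdjoinRoot f from y))
    rw [eval_C] at h
    exact h⟩
  smul_eq_zero_iff r := by
    obtain ⟨p, rfl⟩ := polyToEnveloping_surjective f r
    have h := polyToEnveloping_smul f p
    constructor
    · intro hp
      have hroot : p.eval (AdjoinRoot.root f) = 0 := h.symm.trans hp
      exact map_dvd _ (dvd_iff_isRoot.2 hroot)
    · rintro ⟨c, hc⟩
      obtain ⟨c, rfl⟩ := polyToEnveloping_surjective f c
      rw [hc, ← map_mul]
      refine (polyToEnveloping_smul f _).trans ?_
      rw [eval_mul, eval_sub, eval_X, eval_C, sub_self, zero_mul]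
      rfl

end Ring

/-! ### Divisibility by the gcd of a polynomial and its derivative -/

section Gcd
variable {k : Type u} [Field k] {f d q : k[X]}

theorem monogenicU_eq_hasseDeriv (f q : k[X]) : monogenicU f q = q ^ 2 * hasseDeriv 2 f := by
  rw [monogenicU, hasseDeriv_apply, sum_over_range _ (by simp)]
  congr 1
  refine Finset.sum_congr rfl fun i _ => ?_
  rw [Nat.choose_two_right, C_mul_X_pow_eq_monomial, mul_comm]

theorem exists_eq_combination_of_isGCD
    (hd : ∀ e : k[X], e ∣ f → e ∣ derivative f → e ∣ d) :
    ∃ a b : k[X], d = a * f + b * derivative f := by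
  classical
  obtain ⟨c, hc⟩ := hd _ (EuclideanDomain.gcd_dvd_left f (derivative f))
    (EuclideanDomain.gcd_dvd_right f (derivative f))
  refine ⟨c * EuclideanDomain.gcdA f (derivative f), c * EuclideanDomain.gcdB f (derivative f), ?_⟩
  rw [hc]
  conv_lhs => rw [EuclideanDomain.gcd_eq_gcd_ab f (derivative f)]
  ring

theorem dvd_mul_right_iff_of_eq_mul (hf : f.Monic) (hq : f = q * d) (p : k[X]) :
    f ∣ p * q ↔ d ∣ p := by
  have hq0 : q ≠ 0 := by
    rintro rfl
    exact hf.ne_zero (by rw [hq, zero_mul])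
  rw [mul_comm p q]
  conv_lhs => rw [hq]
  exact mul_dvd_mul_iff_left hq0

/-- The annihilator of `f'` in `k[x]/(f)` is generated by `q = f / d`. -/
theorem dvd_of_dvd_derivative_mul (hf : f.Monic) (hq : f = q * d)
    (hd : ∀ e : k[X], e ∣ f → e ∣ derivative f → e ∣ d) {a : k[X]}
    (ha : f ∣ derivative f * a) : q ∣ a := by
  obtain ⟨α, β, h⟩ := exists_eq_combination_of_isGCD hd
  have hd0 : d ≠ 0 := by
    rintro rfl
    exact hf.ne_zero (by rw [hq, mul_zero])
  have : f ∣ a * d := by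
    rw [h, show a * (α * f + β * derivative f) = f * (α * a) + derivative f * a * β by ring]
    exact dvd_add (dvd_mul_right _ _) (ha.mul_right _)
  rw [hq] at this
  exact (mul_dvd_mul_iff_right hd0).1 this

/-- The ideal generated by `f` and `f'` is generated by `d`. -/
theorem exists_dvd_sub_derivative_mul_iff (hdf : d ∣ f) (hdf' : d ∣ derivative f)
    (hd : ∀ e : k[X], e ∣ f → e ∣ derivative f → e ∣ d) (p : k[X]) :
    (∃ c, f ∣ p - derivative f * c) ↔ d ∣ p := by
  constructor
  · rintro ⟨c, hc⟩
    exact (dvd_sub_left (hdf'.mul_right c)).1 (hdf.trans hc)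
  · rintro ⟨e, rfl⟩
    obtain ⟨α, β, h⟩ := exists_eq_combination_of_isGCD hd
    refine ⟨β * e, α * e, ?_⟩
    rw [h]
    ring

theorem dvd_derivative_mul (hq : f = q * d) (hdf' : d ∣ derivative f) :
    f ∣ derivative f * q := by
  rw [mul_comm]
  conv_lhs => rw [hq]
  exact mul_dvd_mul_left q hdf'

/-- `2u` vanishes modulo `f`. This is what reconciles `τ² = u ζ` with graded commutativity. -/
theorem dvd_two_mul_monogenicU (hq : f = q * d) (hdf' : d ∣ derivative f) :
    f ∣ 2 * monogenicU f q := by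
  -- Differentiate `f' * q = f * g` and multiply by `q`.
  obtain ⟨g, hg⟩ := dvd_derivative_mul hq hdf'
  have h2 : (2 : k[X]) * hasseDeriv 2 f = derivative (derivative f) := by
    have h : Nat.factorial 2 • hasseDeriv 2 f = derivative (derivative f) :=
      congrFun (factorial_smul_hasseDeriv (R := k) 2) f
    rw [← h, Nat.factorial_two, two_mul, two_nsmul]
  have hg' := congrArg derivative hg
  rw [derivative_mul, derivative_mul] at hg'
  refine ⟨g * g + derivative g * q - derivative q * g, ?_⟩
  rw [monogenicU_eq_hasseDeriv, show 2 * (q ^ 2 * hasseDeriv 2 f) =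
    q * ((2 * hasseDeriv 2 f) * q) by ring, h2]
  linear_combination q * hg' + (g - derivative q) * hg

end Gcd

/-! ### Generators of the Hochschild cohomology -/

section Classes
variable {k : Type u} [Field k] (f : k[X])

/-- The homomorphism `p ↦ p(x) ⊗ 1` from `k[X]` to the enveloping algebra of `k[x]/(f)`. -/
noncomputable def coeffHom : k[X] →+* EnvelopingAlgebra k (AdjoinRoot f) :=
  (polyToEnveloping f).comp (C.comp (AdjoinRoot.mk f))

theorem dvd_polyToEnveloping_iff (p : (AdjoinRoot f)[X]) :
    polyToEnveloping f (X - C (AdjoinRoot.root f)) ∣ polyToEnveloping f p ↔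
      p.eval (AdjoinRoot.root f) = 0 := by
  rw [← (isCyclicGenerator_regularBimodule f).smul_eq_zero_iff]
  have := polyToEnveloping_smul f p
  constructor
  · exact fun h => this.symm.trans h
  · exact fun h => this.trans h

theorem dvd_sub_coeffHom_iff (P : (AdjoinRoot f)[X]) (p : k[X]) :
    polyToEnveloping f (X - C (AdjoinRoot.root f)) ∣ polyToEnveloping f P - coeffHom f p ↔
      P.eval (AdjoinRoot.root f) = AdjoinRoot.mk f p := by
  rw [coeffHom, RingHom.comp_apply, ← map_sub, dvd_polyToEnveloping_iff, eval_sub, sub_eq_zero]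
  simp

theorem exists_dvd_sub_coeffHom (r : EnvelopingAlgebra k (AdjoinRoot f)) :
    ∃ p, polyToEnveloping f (X - C (AdjoinRoot.root f)) ∣ r - coeffHom f p := by
  obtain ⟨P, rfl⟩ := polyToEnveloping_surjective f r
  obtain ⟨p, hp⟩ := AdjoinRoot.mk_surjective (P.eval (AdjoinRoot.root f))
  exact ⟨p, (dvd_sub_coeffHom_iff f P p).2 hp.symm⟩

theorem dvd_coeffHom_iff (p : k[X]) :
    polyToEnveloping f (X - C (AdjoinRoot.root f)) ∣ coeffHom f p ↔ f ∣ p := by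
  rw [coeffHom, RingHom.comp_apply, dvd_polyToEnveloping_iff]
  simp [AdjoinRoot.mk_eq_zero]

/-- Every scalar acts on `Ext(-, A)` as the scalar `p(x) ⊗ 1` of some polynomial `p`, since
`1 ⊗ x - x ⊗ 1` acts as zero. -/
theorem exists_smul_coeffHom_eq {P : ModuleCat.{u} (EnvelopingAlgebra k (AdjoinRoot f))} {n : ℕ}
    (r : EnvelopingAlgebra k (AdjoinRoot f))
    (y : Ext.{u} P (regularBimodule k (AdjoinRoot f)) n) : ∃ p, r • y = coeffHom f p • y := by
  obtain ⟨p, c, hc⟩ := exists_dvd_sub_coeffHom f r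
  refine ⟨p, ?_⟩
  rw [← sub_eq_zero, ← sub_smul, hc, mul_smul]
  exact (isCyclicGenerator_regularBimodule f).smul_ext_eq_zero _

/-- The generators `τ ∈ HH¹` and `ζ ∈ HH²` of the Hochschild cohomology of `k[x]/(f)`, together
with the properties that determine its ring structure. -/
theorem exists_tau_zeta (hf : f.Monic) {d q : k[X]}
    (hdf : d ∣ f) (hdf' : d ∣ derivative f)
    (hd : ∀ e : k[X], e ∣ f → e ∣ derivative f → e ∣ d) (hq : f = q * d) :
    ∃ (τ : HH k (AdjoinRoot f) 1) (ζ : HH k (AdjoinRoot f) 2),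
      (∀ y : HH k (AdjoinRoot f) 1, ∃ p, y = coeffHom f p • τ) ∧
      (∀ p, coeffHom f p • τ = 0 ↔ d ∣ p) ∧
      (∀ p, coeffHom f p • ζ = 0 ↔ d ∣ p) ∧
      (∀ (n : ℕ) (y : HH k (AdjoinRoot f) (n + 2)),
        ∃ y' : HH k (AdjoinRoot f) n, ζ.comp y' (add_comm 2 n) = y) ∧
      (∀ (n : ℕ) (y : HH k (AdjoinRoot f) (n + 1)), ζ.comp y (add_comm 2 _) = 0 → y = 0) ∧
      τ.comp τ (rfl : 1 + 1 = 2) = coeffHom f (monogenicU f q) • ζ ∧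
      τ.comp ζ (rfl : 1 + 2 = 3) = ζ.comp τ (rfl : 2 + 1 = 3) := by
  let x := AdjoinRoot.root f
  let F : (AdjoinRoot f)[X] := f.map (algebraMap k _)
  let ψ := polyToEnveloping f
  have hev (p : k[X]) : (p.map (algebraMap k _)).eval x = AdjoinRoot.mk f p := by
    rw [eval_map_algebraMap, AdjoinRoot.aeval_eq]
  have hF1 : (derivative F).eval x = AdjoinRoot.mk f (derivative f) := by
    rw [derivative_map, hev]
  have hF2 : (hasseDeriv 2 F).eval x = AdjoinRoot.mk f (hasseDeriv 2 f) := by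
    rw [← hev]
    congr 1
    ext i
    simp [F, hasseDeriv_coeff]
  -- Over `A` the Taylor expansion of `f` at its root `x` reads `f(X) = (X - x) t(X)` with
  -- `t = f'(x) + (X - x) w` and `w(x) = (f'' / 2)(x)`; the exact pair is formed by `X - x` and `t`.
  obtain ⟨g, hg⟩ := exists_eq_taylor_two F x
  rw [hev, AdjoinRoot.mk_self, C_0, zero_add, hF1, hF2] at hg
  set w : (AdjoinRoot f)[X] := C (AdjoinRoot.mk f (hasseDeriv 2 f)) + (X - C x) * g with hw
  set t : (AdjoinRoot f)[X] := C (AdjoinRoot.mk f (derivative f)) + (X - C x) * w with ht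
  have hFm : F.Monic := hf.map _
  have hsm : (X - C x).Monic := monic_X_sub_C x
  have htm : t.Monic := hsm.of_mul_monic_left (hg ▸ hFm)
  have hpair : IsExactPair (ψ (X - C x)) (ψ t) :=
    isExactPair_map ψ (polyToEnveloping_surjective f) hsm htm fun p => by
      rw [← hg]
      exact polyToEnveloping_eq_zero_iff f hf p
  have hM := isCyclicGenerator_regularBimodule f
  have hN := IsCyclicGenerator.quotient (ψ t)
  have hqf : AdjoinRoot.mk f (derivative f) * AdjoinRoot.mk f q = 0 := by
    rw [← map_mul, AdjoinRoot.mk_eq_zero]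
    exact dvd_derivative_mul hq hdf'
  -- Since `f'(x) q(x) = 0`, multiplying `t` by `q(x)` leaves `(X - x) w q(x)`. The cofactor
  -- `w q(x)` becomes `(f'' / 2)(x) q(x)` on `A`, whence the value `u = q² (f'' / 2)` of `τ² / ζ`.
  have hqc : ψ t * coeffHom f q = ψ (X - C x) * ψ (w * C (AdjoinRoot.mk f q)) := by
    rw [coeffHom, RingHom.comp_apply, ← map_mul, ← map_mul, RingHom.comp_apply]
    congr 1
    rw [ht, add_mul, ← C_mul, hqf, C_0]
    ring
  have hteval : t.eval x = AdjoinRoot.mk f (derivative f) := by simp [ht]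
  have hq0 : ψ t • coeffHom f q •
      (show regularBimodule k (AdjoinRoot f) from (1 : AdjoinRoot f)) = 0 := by
    rw [← mul_smul, hM.smul_eq_zero_iff, hqc]
    exact dvd_mul_right _ _
  refine ⟨hM.tauClass hN hpair hq0, hM.zetaClass hN hpair, ?_, ?_, ?_, ?_, ?_, ?_, ?_⟩
  · intro y
    obtain ⟨r, rfl⟩ := hM.exists_smul_tauClass_eq hN hpair hq0 (by
      intro a ha
      obtain ⟨P, rfl⟩ := polyToEnveloping_surjective f a
      rw [← map_mul, dvd_polyToEnveloping_iff, eval_mul, hteval] at ha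
      obtain ⟨p, hp⟩ := AdjoinRoot.mk_surjective (P.eval (AdjoinRoot.root f))
      rw [← hp, ← map_mul, AdjoinRoot.mk_eq_zero] at ha
      obtain ⟨b, rfl⟩ := dvd_of_dvd_derivative_mul hf hq hd ha
      refine ⟨coeffHom f b, ?_⟩
      rw [← map_mul, dvd_sub_coeffHom_iff, ← hp, mul_comm]) y
    exact exists_smul_coeffHom_eq f r _
  · intro p
    rw [hM.smul_tauClass_eq_zero_iff, ← map_mul, dvd_coeffHom_iff]
    exact dvd_mul_right_iff_of_eq_mul hf hq p
  · intro p
    rw [hM.smul_zetaClass_eq_zero_iff, ← exists_dvd_sub_derivative_mul_iff hdf hdf' hd]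
    have key (P : (AdjoinRoot f)[X]) (c : k[X]) (h : P.eval x = AdjoinRoot.mk f c) :
        ψ (X - C x) ∣ coeffHom f p - ψ t * ψ P ↔ f ∣ p - derivative f * c := by
      rw [← map_mul, dvd_sub_comm, dvd_sub_coeffHom_iff, eval_mul, hteval, h, ← map_mul,
        ← sub_eq_zero, ← map_sub, AdjoinRoot.mk_eq_zero, dvd_sub_comm]
    constructor
    · rintro ⟨r, hr⟩
      obtain ⟨P, rfl⟩ := polyToEnveloping_surjective f r
      obtain ⟨c, hc⟩ := AdjoinRoot.mk_surjective (P.eval (AdjoinRoot.root f))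
      exact ⟨c, (key P c hc.symm).1 hr⟩
    · rintro ⟨c, hc⟩
      exact ⟨ψ (C (AdjoinRoot.mk f c)), (key _ c eval_C).2 hc⟩
  · exact fun n y => hM.exists_zetaClass_comp_eq hN hpair _ y
  · exact fun n y hy => hM.eq_zero_of_zetaClass_comp hN hpair _ y hy
  · rw [hM.tauClass_comp_tauClass hN hpair hqc hq0, ← sub_eq_zero, ← sub_smul]
    have hdvd : ψ (X - C x) ∣
        coeffHom f q * ψ (w * C (AdjoinRoot.mk f q)) - coeffHom f (monogenicU f q) := by
      rw [coeffHom, RingHom.comp_apply, ← map_mul]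
      rw [← coeffHom, dvd_sub_coeffHom_iff, monogenicU_eq_hasseDeriv]
      simp [hw]
      ring
    obtain ⟨c, hc⟩ := hdvd
    rw [hc, mul_smul]
    exact hM.smul_ext_eq_zero _
  · exact hM.tauClass_comp_zetaClass hN hpair hqc hq0

end Classes

/-! ### Normal forms in the presented algebra -/

section NormalForm

section Monoid

variable {S : Type*} [Monoid S]

/-- The monomial `τ^ε ζ^m` of degree `n = 2m + ε`, where `ε ∈ {0, 1}`. -/
def normalMonomial (τ ζ : S) (n : ℕ) : S := τ ^ (n % 2) * ζ ^ (n / 2)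

theorem normalMonomial_zero (τ ζ : S) : normalMonomial τ ζ 0 = 1 := by
  simp [normalMonomial]

theorem normalMonomial_one (τ ζ : S) : normalMonomial τ ζ 1 = τ := by
  simp [normalMonomial]

theorem normalMonomial_mul_zeta (τ ζ : S) (n : ℕ) :
    normalMonomial τ ζ n * ζ = normalMonomial τ ζ (n + 2) := by
  rw [normalMonomial, normalMonomial, Nat.add_mod_right, Nat.add_div_right n two_pos, pow_succ,
    mul_assoc]

theorem normalMonomial_even (τ ζ : S) (m : ℕ) : normalMonomial τ ζ (2 * m) = ζ ^ m := by
  rw [normalMonomial, Nat.mul_mod_right, Nat.mul_div_cancel_left m two_pos, pow_zero, one_mul]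

theorem normalMonomial_odd (τ ζ : S) (m : ℕ) :
    normalMonomial τ ζ (2 * m + 1) = τ * ζ ^ m := by
  rw [normalMonomial, show (2 * m + 1) % 2 = 1 by omega, show (2 * m + 1) / 2 = m by omega,
    pow_one]

end Monoid

variable {S : Type*} [CommRing S]

theorem normalMonomial_even_mul_tau (τ ζ : S) (m : ℕ) :
    normalMonomial τ ζ (2 * m) * τ = normalMonomial τ ζ (2 * m + 1) := by
  rw [normalMonomial_even, normalMonomial_odd, mul_comm]

theorem normalMonomial_odd_mul_tau {τ ζ w : S} (h : τ ^ 2 = w * ζ) (m : ℕ) :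
    normalMonomial τ ζ (2 * m + 1) * τ = w * normalMonomial τ ζ (2 * m + 2) := by
  rw [normalMonomial_odd, show 2 * m + 2 = 2 * (m + 1) by ring, normalMonomial_even]
  linear_combination ζ ^ m * h

variable {k : Type*} [Field k] [Algebra k S]

/-- The linear map sending `(pₙ)ₙ` to `∑ₙ pₙ(x) eₙ`, where `eₙ` is the monomial `τ^ε ζ^m` of
degree `n`. -/
noncomputable def normalForm (k : Type*) [Field k] [Algebra k S] (x τ ζ : S) :
    (ℕ →₀ k[X]) →ₗ[k] S :=
  Finsupp.lsum k fun n => LinearMap.mulRight k (normalMonomial τ ζ n) ∘ₗ (aeval x).toLinearMap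

theorem normalForm_apply (x τ ζ : S) (c : ℕ →₀ k[X]) :
    normalForm k x τ ζ c = c.sum fun n p => aeval x p * normalMonomial τ ζ n := rfl

theorem normalForm_single (x τ ζ : S) (n : ℕ) (p : k[X]) :
    normalForm k x τ ζ (Finsupp.single n p) = aeval x p * normalMonomial τ ζ n := by
  rw [normalForm_apply, Finsupp.sum_single_index]
  rw [map_zero, zero_mul]

/-- If `τ² = u(x) ζ`, then every polynomial in `x`, `τ`, `ζ` has a normal form. -/
theorem aeval_mem_range_normalForm {x τ ζ : S} {u : k[X]} (h : τ ^ 2 = aeval x u * ζ)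
    (P : MvPolynomial (Fin 3) k) :
    MvPolynomial.aeval ![x, τ, ζ] P ∈ LinearMap.range (normalForm k x τ ζ) := by
  have mem (n : ℕ) (p : k[X]) :
      aeval x p * normalMonomial τ ζ n ∈ LinearMap.range (normalForm k x τ ζ) :=
    ⟨_, normalForm_single x τ ζ n p⟩
  induction P using MvPolynomial.induction_on with
  | C a =>
    have := mem 0 (C a)
    rw [normalMonomial_zero, mul_one, aeval_C] at this
    rwa [MvPolynomial.aeval_C]
  | add P Q hP hQ =>
    rw [map_add]
    exact add_mem hP hQ
  | mul_X P i hP =>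
    rw [map_mul, MvPolynomial.aeval_X]
    obtain ⟨c, hc⟩ := hP
    rw [← hc]
    clear hc
    induction c using Finsupp.induction_linear with
    | zero => rw [map_zero, zero_mul]; exact zero_mem _
    | add c c' hc hc' => rw [map_add, add_mul]; exact add_mem hc hc'
    | single n p =>
      rw [normalForm_single]
      fin_cases i
      · change _ * x ∈ _
        have := mem n (p * X)
        rwa [map_mul, aeval_X, mul_right_comm] at this
      · change _ * τ ∈ _
        rw [mul_assoc]
        obtain ⟨m, rfl | rfl⟩ := n.even_or_odd'
        · rw [normalMonomial_even_mul_tau]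
          exact mem _ _
        · rw [normalMonomial_odd_mul_tau h, ← mul_assoc, ← map_mul]
          exact mem _ _
      · change _ * ζ ∈ _
        rw [mul_assoc, normalMonomial_mul_zeta]
        exact mem _ _

/-- The ideal `(d)` kills every monomial of positive degree; for `ζ` this uses that `d` is a
combination of `f` and `f'`. -/
theorem aeval_mul_normalMonomial_eq_zero {x τ ζ : S} {f d : k[X]}
    (hd : ∃ a b : k[X], d = a * f + b * derivative f) (hf : aeval x f = 0)
    (hτ : τ * aeval x d = 0) (hζ : ζ * aeval x (derivative f) = 0) {n : ℕ} {p : k[X]}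
    (hp : d ∣ p) (hn : n ≠ 0) : aeval x p * normalMonomial τ ζ n = 0 := by
  obtain ⟨p, rfl⟩ := hp
  have hζd : ζ * aeval x d = 0 := by
    obtain ⟨a, b, rfl⟩ := hd
    rw [map_add, map_mul, map_mul, hf]
    linear_combination aeval x b * hζ
  rw [map_mul]
  obtain ⟨m, rfl | rfl⟩ := n.even_or_odd'
  · obtain ⟨m, rfl⟩ : ∃ l, m = l + 1 := ⟨m - 1, by omega⟩
    rw [normalMonomial_even, pow_succ]
    linear_combination aeval x p * ζ ^ m * hζd
  · rw [normalMonomial_odd]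
    linear_combination aeval x p * ζ ^ m * hτ

end NormalForm

section Presentation

variable {k : Type u} [Field k] {H : Type v} [CommRing H] [Algebra k H]

theorem aeval_mem_of_isWeightedHomogeneous (D : ℕ → Submodule k H) [SetLike.GradedMonoid D]
    {x τ ζ : H} (hx : x ∈ D 0) (hτ : τ ∈ D 1) (hζ : ζ ∈ D 2) {n : ℕ}
    {P : MvPolynomial (Fin 3) k}
    (hP : MvPolynomial.IsWeightedHomogeneous (![0, 1, 2] : Fin 3 → ℕ) P n) :
    MvPolynomial.aeval ![x, τ, ζ] P ∈ D n := by
  rw [MvPolynomial.aeval_def, MvPolynomial.eval₂_eq']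
  refine sum_mem fun c hc => ?_
  rw [← Algebra.smul_def]
  refine (D n).smul_mem _ ?_
  have hw := hP (MvPolynomial.mem_support_iff.1 hc)
  rw [Finsupp.weight_apply, Finsupp.sum_fintype _ _ (by simp)] at hw
  rw [← hw]
  simp only [Fin.prod_univ_three, Fin.sum_univ_three]
  exact SetLike.mul_mem_graded (SetLike.mul_mem_graded (SetLike.pow_mem_graded _ hx)
    (SetLike.pow_mem_graded _ hτ)) (SetLike.pow_mem_graded _ hζ)

theorem isWeightedHomogeneous_aeval_X_zero (p : k[X]) :
    MvPolynomial.IsWeightedHomogeneous (![0, 1, 2] : Fin 3 → ℕ)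
      (aeval (MvPolynomial.X 0 : MvPolynomial (Fin 3) k) p) 0 := by
  induction p using Polynomial.induction_on' with
  | add p q hp hq =>
    rw [map_add]
    exact hp.add hq
  | monomial n a =>
    rw [aeval_monomial]
    have := (MvPolynomial.isWeightedHomogeneous_C (![0, 1, 2] : Fin 3 → ℕ) a).mul
      ((MvPolynomial.isWeightedHomogeneous_X k (![0, 1, 2] : Fin 3 → ℕ) 0).pow n)
    simpa using this

theorem isWeightedHomogeneous_normalMonomial (n : ℕ) (p : k[X]) :
    MvPolynomial.IsWeightedHomogeneous (![0, 1, 2] : Fin 3 → ℕ)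
      (aeval (MvPolynomial.X 0 : MvPolynomial (Fin 3) k) p *
        normalMonomial (MvPolynomial.X 1) (MvPolynomial.X 2) n) n := by
  have hτ := (MvPolynomial.isWeightedHomogeneous_X k (![0, 1, 2] : Fin 3 → ℕ) 1).pow (n % 2)
  have hζ := (MvPolynomial.isWeightedHomogeneous_X k (![0, 1, 2] : Fin 3 → ℕ) 2).pow (n / 2)
  have h := (isWeightedHomogeneous_aeval_X_zero p).mul (hτ.mul hζ)
  have hn : 0 + ((n % 2) • (![0, 1, 2] : Fin 3 → ℕ) 1 +
      (n / 2) • (![0, 1, 2] : Fin 3 → ℕ) 2) = n := by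
    change 0 + (n % 2 * 1 + n / 2 * 2) = n
    omega
  rw [hn] at h
  exact h

/-- A graded commutative algebra whose component of degree `0` is `k[x]/(f)` and whose component of
degree `n > 0` is free of rank one over `k[x]/(d)` on the monomial `τ^ε ζ^m` of degree `n` is
presented by the relations among `x`, `τ`, `ζ`. -/
theorem exists_algEquiv_monogenicPresentation (D : ℕ → Submodule k H) [SetLike.GradedMonoid D]
    (hind : ∀ (s : Finset ℕ) (v : ℕ → H), (∀ n, v n ∈ D n) → ∑ n ∈ s, v n = 0 → ∀ n ∈ s, v n = 0)
    (hspan : ⨆ n, D n = ⊤) {f d u : k[X]}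
    (hd : ∃ a b : k[X], d = a * f + b * derivative f)
    {x τ ζ : H} (hx : x ∈ D 0) (hτ : τ ∈ D 1) (hζ : ζ ∈ D 2)
    (hxf : aeval x f = 0) (hτd : τ * aeval x d = 0) (hζf : ζ * aeval x (derivative f) = 0)
    (hτζ : τ ^ 2 = aeval x u * ζ)
    (hgen : ∀ n, ∀ y ∈ D n, ∃ p : k[X], y = aeval x p * normalMonomial τ ζ n)
    (hzero : ∀ p : k[X], aeval x p = 0 → f ∣ p)
    (hsucc : ∀ (n : ℕ) (p : k[X]), n ≠ 0 → aeval x p * normalMonomial τ ζ n = 0 → d ∣ p) :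
    ∃ e : MonogenicPresentation f d u ≃ₐ[k] H,
      ∀ n : ℕ, (MonogenicPresentation.component f d u n).map e.toLinearEquiv.toLinearMap = D n := by
  let Φ : MvPolynomial (Fin 3) k →ₐ[k] H := MvPolynomial.aeval ![x, τ, ζ]
  let π : MvPolynomial (Fin 3) k →ₐ[k] MonogenicPresentation f d u :=
    Ideal.Quotient.mkₐ k (monogenicIdeal f d u)
  have hΦx : Φ (MvPolynomial.X 0) = x := MvPolynomial.aeval_X _ _
  have hΦτ : Φ (MvPolynomial.X 1) = τ := MvPolynomial.aeval_X _ _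
  have hΦζ : Φ (MvPolynomial.X 2) = ζ := MvPolynomial.aeval_X _ _
  have hle : ∀ P ∈ monogenicIdeal f d u, Φ P = 0 := by
    change monogenicIdeal f d u ≤ RingHom.ker Φ
    rw [monogenicIdeal, Ideal.span_le]
    rintro _ (rfl | rfl | rfl | rfl) <;> rw [SetLike.mem_coe, RingHom.mem_ker]
    · rw [← aeval_algHom_apply, hΦx, hxf]
    · rw [map_mul, ← aeval_algHom_apply, hΦx, hΦτ, hτd]
    · rw [map_mul, ← aeval_algHom_apply, hΦx, hΦζ, hζf]
    · rw [map_sub, map_pow, map_mul, ← aeval_algHom_apply, hΦx, hΦτ, hΦζ, hτζ, sub_self]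
  let φ : MonogenicPresentation f d u →ₐ[k] H := Ideal.Quotient.liftₐ _ Φ hle
  have hπ : Function.Surjective π := Ideal.Quotient.mkₐ_surjective k _
  -- The defining relations hold in the quotient.
  have hrel (P : MvPolynomial (Fin 3) k) (hP : P ∈ monogenicIdeal f d u) : π P = 0 :=
    Ideal.Quotient.eq_zero_iff_mem.2 hP
  set x' := π (MvPolynomial.X 0) with hx'
  set τ' := π (MvPolynomial.X 1) with hτ'
  set ζ' := π (MvPolynomial.X 2) with hζ'
  have hxf' : aeval x' f = 0 := by
    rw [hx', aeval_algHom_apply]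
    exact hrel _ (Ideal.subset_span (by simp))
  have hτd' : τ' * aeval x' d = 0 := by
    rw [hx', aeval_algHom_apply, hτ', ← map_mul]
    exact hrel _ (Ideal.subset_span (by simp))
  have hζf' : ζ' * aeval x' (derivative f) = 0 := by
    rw [hx', aeval_algHom_apply, hζ', ← map_mul]
    exact hrel _ (Ideal.subset_span (by simp))
  have hτζ' : τ' ^ 2 = aeval x' u * ζ' := by
    rw [← sub_eq_zero, hx', aeval_algHom_apply, hζ', hτ', ← map_mul, ← map_pow, ← map_sub]
    exact hrel _ (Ideal.subset_span (by simp))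
  have hπ' : π = MvPolynomial.aeval ![x', τ', ζ'] := by
    refine MvPolynomial.algHom_ext fun i => ?_
    rw [MvPolynomial.aeval_X]
    fin_cases i <;> rfl
  have hφnormal (n : ℕ) (p : k[X]) : φ (aeval x' p * normalMonomial τ' ζ' n) =
      aeval x p * normalMonomial τ ζ n := by
    rw [map_mul, ← aeval_algHom_apply, normalMonomial, map_mul, map_pow, map_pow]
    change aeval (Φ (MvPolynomial.X 0)) p *
      (Φ (MvPolynomial.X 1) ^ _ * Φ (MvPolynomial.X 2) ^ _) = _
    rw [hΦx, hΦτ, hΦζ, normalMonomial]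
  have hmem (n : ℕ) (P : MvPolynomial (Fin 3) k)
      (hP : MvPolynomial.IsWeightedHomogeneous (![0, 1, 2] : Fin 3 → ℕ) P n) : Φ P ∈ D n :=
    aeval_mem_of_isWeightedHomogeneous D hx hτ hζ hP
  have hhom (n : ℕ) (p : k[X]) : MvPolynomial.IsWeightedHomogeneous (![0, 1, 2] : Fin 3 → ℕ)
      (aeval (MvPolynomial.X 0 : MvPolynomial (Fin 3) k) p *
        normalMonomial (MvPolynomial.X 1) (MvPolynomial.X 2) n) n :=
    isWeightedHomogeneous_normalMonomial n p
  have hΦnormal (n : ℕ) (p : k[X]) : Φ (aeval (MvPolynomial.X 0 : MvPolynomial (Fin 3) k) p *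
      normalMonomial (MvPolynomial.X 1) (MvPolynomial.X 2) n) =
      aeval x p * normalMonomial τ ζ n := by
    rw [map_mul, ← aeval_algHom_apply, normalMonomial, map_mul, map_pow, map_pow, hΦx, hΦτ, hΦζ,
      normalMonomial]
  have hinj : Function.Injective φ := by
    rw [injective_iff_map_eq_zero]
    intro y hy
    obtain ⟨P, rfl⟩ := hπ y
    obtain ⟨c, hc⟩ := aeval_mem_range_normalForm hτζ' P
    rw [← hπ'] at hc
    rw [← hc, normalForm_apply] at hy ⊢
    rw [Finsupp.sum, map_sum] at hy
    have hv := hind c.support (fun n => φ (aeval x' (c n) * normalMonomial τ' ζ' n))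
      (fun n => by
        rw [hφnormal, ← hΦnormal]
        exact hmem n _ (hhom n _)) hy
    refine Finset.sum_eq_zero fun n hn => ?_
    have hvn := hv n hn
    rw [hφnormal] at hvn
    by_cases h0 : n = 0
    · subst h0
      rw [normalMonomial_zero, mul_one] at hvn
      obtain ⟨b, hb⟩ := hzero _ hvn
      change aeval x' (c 0) * _ = 0
      rw [hb, map_mul, hxf', zero_mul, zero_mul]
    · exact aeval_mul_normalMonomial_eq_zero hd hxf' hτd' hζf' (hsucc n _ h0 hvn) h0
  have hsurj : Function.Surjective φ := by
    have : ⨆ n, D n ≤ LinearMap.range φ.toLinearMap := iSup_le fun n y hy => by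
      obtain ⟨p, rfl⟩ := hgen n y hy
      exact ⟨_, hφnormal n p⟩
    intro y
    exact this (hspan ▸ Submodule.mem_top)
  refine ⟨AlgEquiv.ofBijective φ ⟨hinj, hsurj⟩, fun n => le_antisymm ?_ ?_⟩
  · rintro _ ⟨_, ⟨P, hP, rfl⟩, rfl⟩
    exact hmem n P hP
  · intro y hy
    obtain ⟨p, rfl⟩ := hgen n y hy
    exact ⟨_, ⟨_, hhom n p, rfl⟩, hΦnormal n p⟩

end Presentation

/-! ### The Hochschild cohomology ring -/

section HHStar

section General
variable (k : Type u) (A : Type v) [Field k] [Ring A] [Algebra k A]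

theorem HHStar.of_mul_of {i j n : ℕ} (a : HH k A i) (b : HH k A j) (h : j + i = n) :
    (DirectSum.of (HH k A) i a * DirectSum.of (HH k A) j b : HHStar k A) =
      DirectSum.of (HH k A) n (b.comp a h) := by
  rw [DirectSum.of_mul_of]
  exact DirectSum.of_eq_of_gradedMonoid_eq (HH.mk_comp_eq k A b a _ _)

/-- The homogeneous component of degree `n` of the Hochschild cohomology. -/
noncomputable def HHStar.component (n : ℕ) : Submodule k (HHStar k A) :=
  LinearMap.range (DirectSum.lof k ℕ (HH k A) n)

theorem HHStar.of_mem_component {n : ℕ} (a : HH k A n) :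
    (DirectSum.of (HH k A) n a : HHStar k A) ∈ HHStar.component k A n := ⟨a, rfl⟩

instance HHStar.gradedMonoid_component : SetLike.GradedMonoid (HHStar.component k A) where
  one_mem := ⟨_, rfl⟩
  mul_mem := by
    rintro i j _ _ ⟨a, rfl⟩ ⟨b, rfl⟩
    exact ⟨_, (HHStar.of_mul_of k A a b (add_comm j i)).symm⟩

theorem HHStar.iSup_component : ⨆ n, HHStar.component k A n = ⊤ := by
  rw [eq_top_iff]
  rintro y -
  induction y using DirectSum.induction_on with
  | zero => exact zero_mem _
  | of n a => exact Submodule.mem_iSup_of_mem n (HHStar.of_mem_component k A a)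
  | add a b ha hb => exact add_mem ha hb

theorem HHStar.eq_zero_of_sum_eq_zero (s : Finset ℕ) (v : ℕ → HHStar k A)
    (hv : ∀ n, v n ∈ HHStar.component k A n) (hs : ∑ n ∈ s, v n = 0) : ∀ n ∈ s, v n = 0 := by
  choose y hy using hv
  intro n hn
  have h := congrArg (DirectSum.component k ℕ (HH k A) n) hs
  rw [map_sum, map_zero, Finset.sum_eq_single n] at h
  · rw [← hy, DirectSum.component.lof_self] at h
    rw [← hy, h, map_zero]
  · intro m _ hm
    rw [← hy, DirectSum.component.of, dif_neg hm]
  · exact fun h => (h hn).elim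

end General

section Monogenic
variable {k : Type u} [Field k] (f : k[X])

theorem coeffHom_C_smul {n : ℕ} (c : k) (y : HH k (AdjoinRoot f) n) :
    coeffHom f (C c) • y = c • y := by
  have h : coeffHom f (C c) = algebraMap k _ c := by
    rw [coeffHom, RingHom.comp_apply, RingHom.comp_apply, AdjoinRoot.mk_C]
    simp [polyToEnveloping, Algebra.TensorProduct.algebraMap_apply]
  rw [Ext.smul_eq_comp_mk₀, Ext.smul_eq_comp_mk₀ y c, h]
  congr 2

/-- The algebra homomorphism from `k[X]` to the Hochschild cohomology of `k[x]/(f)` that sends `p`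
to multiplication by `p(x)`. -/
noncomputable def HHStar.ofPoly : k[X] →ₐ[k] HHStar k (AdjoinRoot f) :=
  AlgHom.mk
   { toFun p := DirectSum.of (HH k (AdjoinRoot f)) 0 (coeffHom f p • Ext.mk₀ (𝟙 _))
     map_one' := by
       rw [map_one, one_smul]
       rfl
     map_mul' p p' := by
       rw [HHStar.of_mul_of k (AdjoinRoot f) _ _ (add_zero 0), Ext.comp_smul,
         Ext.comp_mk₀_id, map_mul, mul_smul]
     map_zero' := by
       have h : coeffHom f 0 • Ext.mk₀ (𝟙 (regularBimodule k (AdjoinRoot f))) = 0 := by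
         rw [map_zero]
         exact zero_smul (EnvelopingAlgebra k (AdjoinRoot f))
           (Ext.mk₀ (𝟙 (regularBimodule k (AdjoinRoot f))))
       rw [h, map_zero]
     map_add' p p' := by rw [map_add, add_smul, map_add] }
   (fun c => by
     change DirectSum.of (HH k (AdjoinRoot f)) 0 (coeffHom f (C c) • Ext.mk₀ (𝟙 _)) = _
     rw [coeffHom_C_smul]
     rfl)

theorem HHStar.ofPoly_mul_of {n : ℕ} (p : k[X]) (y : HH k (AdjoinRoot f) n) :
    HHStar.ofPoly f p * DirectSum.of (HH k (AdjoinRoot f)) n y =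
      DirectSum.of (HH k (AdjoinRoot f)) n (coeffHom f p • y) := by
  refine (HHStar.of_mul_of k (AdjoinRoot f) _ _ (add_zero n)).trans ?_
  rw [Ext.comp_smul, Ext.comp_mk₀_id]

theorem HHStar.of_mul_ofPoly {n : ℕ} (p : k[X]) (y : HH k (AdjoinRoot f) n) :
    DirectSum.of (HH k (AdjoinRoot f)) n y * HHStar.ofPoly f p =
      DirectSum.of (HH k (AdjoinRoot f)) n (coeffHom f p • y) := by
  refine (HHStar.of_mul_of k (AdjoinRoot f) _ _ (zero_add n)).trans ?_
  rw [Ext.smul_comp, Ext.mk₀_id_comp]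

theorem HHStar.ofPoly_eq_aeval (p : k[X]) :
    aeval (HHStar.ofPoly f X) p = HHStar.ofPoly f p := by
  rw [aeval_algHom_apply, aeval_X_left_apply]

theorem HHStar.of_eq_zero_iff {k : Type u} {A : Type v} [Field k] [Ring A] [Algebra k A] {n : ℕ}
    {y : HH k A n} : DirectSum.of (HH k A) n y = 0 ↔ y = 0 :=
  map_eq_zero_iff _ (DirectSum.of_injective n)

end Monogenic

end HHStar

theorem mainTheorem4 {k : Type u} [Field k] (f : Polynomial k) (hf : f.Monic)
    (d q : Polynomial k)
    (hdf : d ∣ f) (hdf' : d ∣ Polynomial.derivative f)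
    (hd : ∀ e : Polynomial k, e ∣ f → e ∣ Polynomial.derivative f → e ∣ d)
    (hq : f = q * d) :
    (∀ (i j : ℕ) (a : HH k (AdjoinRoot f) i) (b : HH k (AdjoinRoot f) j),
      (DirectSum.of (HH k (AdjoinRoot f)) i a * DirectSum.of (HH k (AdjoinRoot f)) j b :
          HHStar k (AdjoinRoot f)) =
        (-1) ^ (i * j) *
          (DirectSum.of (HH k (AdjoinRoot f)) j b * DirectSum.of (HH k (AdjoinRoot f)) i a)) ∧
    ∃ e : MonogenicPresentation f d (monogenicU f q) ≃ₐ[k] HHStar k (AdjoinRoot f),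
      ∀ n : ℕ, (MonogenicPresentation.component f d (monogenicU f q) n).map
          e.toLinearEquiv.toLinearMap =
        LinearMap.range (DirectSum.lof k ℕ (HH k (AdjoinRoot f)) n) := by
  obtain ⟨τ, ζ, hτgen, hτ0, hζ0, hζsurj, hζinj, hττ, hτζ⟩ := exists_tau_zeta f hf hdf hdf' hd hq
  let ρ := HHStar.ofPoly f
  let D := HHStar.component k (AdjoinRoot f)
  let T : HHStar k (AdjoinRoot f) := DirectSum.of (HH k (AdjoinRoot f)) 1 τ
  let Z : HHStar k (AdjoinRoot f) := DirectSum.of (HH k (AdjoinRoot f)) 2 ζ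
  have hM := isCyclicGenerator_regularBimodule f
  have hTD : T ∈ D 1 := HHStar.of_mem_component k _ τ
  have hZD : Z ∈ D 2 := HHStar.of_mem_component k _ ζ
  have hρD (p : k[X]) : ρ p ∈ D 0 := HHStar.of_mem_component k _ _
  have hND (n : ℕ) : normalMonomial T Z n ∈ D n := by
    have h := SetLike.mul_mem_graded (SetLike.pow_mem_graded (n % 2) hTD)
      (SetLike.pow_mem_graded (n / 2) hZD)
    have hn : (n % 2) • 1 + (n / 2) • 2 = n := by
      rw [smul_eq_mul, smul_eq_mul]
      omega
    rw [hn] at h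
    exact h
  have hmulZ {n : ℕ} (y : HH k (AdjoinRoot f) n) : DirectSum.of (HH k (AdjoinRoot f)) n y * Z =
      DirectSum.of (HH k (AdjoinRoot f)) (n + 2) (ζ.comp y (add_comm 2 n)) :=
    HHStar.of_mul_of k _ _ _ _
  have hTZ : Commute T Z := by
    refine (hmulZ τ).trans ?_
    refine Eq.trans ?_ (HHStar.of_mul_of k _ ζ τ (rfl : 1 + 2 = 3)).symm
    exact congrArg _ hτζ.symm
  have hTT : T ^ 2 = ρ (monogenicU f q) * Z := by
    rw [pow_two, HHStar.ofPoly_mul_of, ← hττ]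
    exact HHStar.of_mul_of k _ _ _ _
  have hρT (p : k[X]) : ρ p * T = 0 ↔ d ∣ p := by
    rw [HHStar.ofPoly_mul_of, HHStar.of_eq_zero_iff, hτ0]
  have hρZ (p : k[X]) : ρ p * Z = 0 ↔ d ∣ p := by
    rw [HHStar.ofPoly_mul_of, HHStar.of_eq_zero_iff, hζ0]
  have hρ (p : k[X]) : ρ p = 0 ↔ f ∣ p := by
    refine HHStar.of_eq_zero_iff.trans ?_
    rw [← dvd_coeffHom_iff]
    exact hM.smul_id_eq_zero_iff _
  have hρcomm (p : k[X]) (y : HHStar k (AdjoinRoot f)) : Commute (ρ p) y := by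
    induction y using DirectSum.induction_on with
    | zero => exact Commute.zero_right _
    | of n a => exact (HHStar.ofPoly_mul_of f p a).trans (HHStar.of_mul_ofPoly f p a).symm
    | add a b ha hb => exact ha.add_right hb
  -- Multiplication by `Z` is onto in degrees at least two and injective on positive degrees, so
  -- the structure of each component follows by induction in steps of two.
  have hgen (n : ℕ) : ∀ y : HH k (AdjoinRoot f) n, ∃ p : k[X],
      DirectSum.of (HH k (AdjoinRoot f)) n y = ρ p * normalMonomial T Z n := by
    induction n using Nat.twoStepInduction with
    | zero =>
      intro y
      obtain ⟨r, rfl⟩ := hM.exists_smul_id_eq y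
      obtain ⟨p, hp⟩ := exists_smul_coeffHom_eq f r (Ext.mk₀ (𝟙 (regularBimodule k (AdjoinRoot f))))
      refine ⟨p, ?_⟩
      rw [normalMonomial_zero, mul_one]
      exact congrArg _ hp
    | one =>
      intro y
      obtain ⟨p, rfl⟩ := hτgen y
      refine ⟨p, ?_⟩
      rw [normalMonomial_one, HHStar.ofPoly_mul_of]
    | more n ih _ =>
      intro y
      obtain ⟨y, rfl⟩ := hζsurj n y
      obtain ⟨p, hp⟩ := ih y
      refine ⟨p, ?_⟩
      rw [← hmulZ, hp, mul_assoc, normalMonomial_mul_zeta]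
  have hzero (n : ℕ) (p : k[X]) : ρ p * normalMonomial T Z (n + 1) = 0 → d ∣ p := by
    induction n using Nat.twoStepInduction with
    | zero =>
      rw [normalMonomial_one, hρT]
      exact id
    | one =>
      rw [← zero_add (1 + 1), ← normalMonomial_mul_zeta, normalMonomial_zero, one_mul, hρZ]
      exact id
    | more n ih _ =>
      intro h
      refine ih ?_
      have hmem := SetLike.mul_mem_graded (hρD p) (hND (n + 1))
      rw [zero_add] at hmem
      obtain ⟨y, hy⟩ := hmem
      change DirectSum.of (HH k (AdjoinRoot f)) (n + 1) y = _ at hy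
      rw [show n + 2 + 1 = n + 1 + 2 by ring, ← normalMonomial_mul_zeta, ← mul_assoc, ← hy,
        hmulZ, HHStar.of_eq_zero_iff] at h
      rw [← hy, hζinj n y h, map_zero]
  have hNcomm (i j : ℕ) : Commute (normalMonomial T Z i) (normalMonomial T Z j) := by
    have hTN : Commute T (normalMonomial T Z j) :=
      ((Commute.refl T).pow_right _).mul_right (hTZ.pow_right _)
    have hZN : Commute Z (normalMonomial T Z j) :=
      (hTZ.symm.pow_right _).mul_right ((Commute.refl Z).pow_right _)
    exact (hTN.pow_left _).mul_left (hZN.pow_left _)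
  have hcomm' (i j : ℕ) (a : HH k (AdjoinRoot f) i) (b : HH k (AdjoinRoot f) j) :
      Commute (DirectSum.of (HH k (AdjoinRoot f)) i a) (DirectSum.of (HH k (AdjoinRoot f)) j b) := by
    obtain ⟨p, hp⟩ := hgen i a
    obtain ⟨p', hp'⟩ := hgen j b
    rw [hp, hp']
    exact (hρcomm p _).mul_left ((hρcomm p' _).symm.mul_right (hNcomm i j))
  have hcomm (a b : HHStar k (AdjoinRoot f)) : Commute a b := by
    induction a using DirectSum.induction_on with
    | zero => exact Commute.zero_left _
    | add a a' ha ha' => exact ha.add_left ha'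
    | of i a =>
      induction b using DirectSum.induction_on with
      | zero => exact Commute.zero_right _
      | add b b' hb hb' => exact hb.add_right hb'
      | of j b => exact hcomm' i j a b
  let _ : CommRing (HHStar k (AdjoinRoot f)) :=
    { (inferInstance : Ring (HHStar k (AdjoinRoot f))) with mul_comm := hcomm }
  refine ⟨fun i j a b => ?_, ?_⟩
  · rcases Nat.even_or_odd (i * j) with h | h
    · rw [h.neg_one_pow, one_mul]
      exact hcomm' i j a b
    · rw [h.neg_one_pow, neg_one_mul, eq_neg_iff_add_eq_zero, (hcomm' j i b a).eq, ← two_mul]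
      obtain ⟨p, hp⟩ := hgen i a
      obtain ⟨p', hp'⟩ := hgen j b
      obtain ⟨⟨l, rfl⟩, ⟨m, rfl⟩⟩ := Nat.odd_mul.1 h
      rw [hp, hp', normalMonomial_odd, normalMonomial_odd]
      have h2 : 2 * T ^ 2 = 0 := by
        have : 2 * ρ (monogenicU f q) = 0 := by
          rw [← map_ofNat ρ 2, ← map_mul, hρ]
          exact dvd_two_mul_monogenicU hq hdf'
        rw [hTT, ← mul_assoc, this, zero_mul]
      -- The product of two classes of odd degree is a multiple of `T ^ 2`.
      linear_combination ρ p * ρ p' * Z ^ l * Z ^ m * h2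
  · refine exists_algEquiv_monogenicPresentation D
      (HHStar.eq_zero_of_sum_eq_zero k _) (HHStar.iSup_component k _)
      (exists_eq_combination_of_isGCD hd) (x := ρ X) (hρD X) hTD hZD ?_ ?_ ?_ ?_ ?_ ?_ ?_
    · rw [HHStar.ofPoly_eq_aeval, hρ]
    · rw [HHStar.ofPoly_eq_aeval, mul_comm, hρT]
    · rw [HHStar.ofPoly_eq_aeval, mul_comm, hρZ]
      exact hdf'
    · rw [HHStar.ofPoly_eq_aeval, hTT]
    · rintro n _ ⟨y, rfl⟩
      obtain ⟨p, hp⟩ := hgen n y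
      exact ⟨p, by rw [HHStar.ofPoly_eq_aeval]; exact hp⟩
    · intro p hp
      rwa [HHStar.ofPoly_eq_aeval, hρ] at hp
    · intro n p hn hp
      obtain ⟨n, rfl⟩ := Nat.exists_eq_succ_of_ne_zero hn
      rw [HHStar.ofPoly_eq_aeval] at hp
      exact hzero n p hp
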